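/- \textbf{Model.} A collection $\mathcal C$ of at least two asynchronous clients, each of which may crash, shares a collection $\mathcal B$ of reliable (never failing) wait-free multi-writer/multi-reader atomic read/write registers with an arbitrary value domain and arbitrary initial values. An algorithm assigns to every client a deterministic state machine that executes the invoked high-level operations by triggering low-level reads and writes on registers in $\mathcal B$, receiving their responses, and finally returning. A client has at most one high-level operation in progress; it may trigger low-level operations on several registers without waiting for responses, but has at most one pending operation per register, and it triggers low-level operations only during a high-level operation. Every low-level operation takes effect atomically at some moment between its trigger and its response. A run is fair if every low-level operation triggered by a correct (never crashing) client eventually gets its response, and every correct client gets infinitely many opportunities to trigger low-level operations and to return. Let $k>0$, let $W\subseteq\mathcal C$ be a fixed set of $k$ clients (the writers), let $\mathbb V$ be a totally ordered set with more than $k$ elements (for example, an infinite one), and let $v_0\in\mathbb V$. A \emph{$k$-writer max-register} over $\mathbb V$ offers $\textit{write-max}(v)$, $v\in\mathbb V$, which only clients in $W$ may invoke and which returns $ok$, and $\textit{read-max}()$, which every client may invoke; in its sequential specification, $\textit{read-max}$ returns the highest value among those written by the preceding $\textit{write-max}$ operations, or $v_0$ if there are none. An algorithm \emph{implements a wait-free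 $k$-writer max-register} if in every finite run the schedule of high-level invocations and returns has a linearization with respect to this specification, and in every fair run every high-level operation invoked by a correct client eventually returns, regardless of the actions (including crashes) of other clients. \textbf{Theorem.} Every algorithm that implements a wait-free $k$-writer max-register from such a collection $\mathcal B$ uses at least $k$ base registers: its resource complexity, i.e. the maximum (supremum) over its finite runs of the number of distinct base registers on which low-level operations are triggered in the run, is at least $k$. In particular $|\mathcal B|\ge k$. -/

import Mathlib

namespace MaxReg

/-! ### High-level operations: the max-register -/

/-- Operations of a max-register over the value domain `V`. -/
inductive HighOp (V : Type*) where
  | writeMax (v : V)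
  | readMax

/-- Responses of a max-register. -/
inductive HighResp (V : Type*) where
  | ok
  | value (v : V)

/-- The values written by a sequence of operations. -/
def writtenValues {V : Type*} (l : List (HighOp V × HighResp V)) : List V :=
  l.filterMap fun x => match x.1 with
    | HighOp.writeMax v => some v
    | HighOp.readMax => none

/-- Sequential specification of a max-register with initial value `v₀`: every `writeMax` answers
`ok`, every `readMax` answers the highest value written before it, or `v₀` if there is none. -/
def Legal {V : Type*} [LinearOrder V] (v₀ : V) (l : List (HighOp V × HighResp V)) : Prop :=
  ∀ (p : ℕ) (op : HighOp V) (r : HighResp V), l[p]? = some (op, r) → match op with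
    | .writeMax _ => r = .ok
    | .readMax => r = .value ((writtenValues (l.take p)).maximum.unbotD v₀)

/-- Events of a schedule of high-level operations. -/
inductive HEvent (C V : Type*) where
  | inv (c : C) (op : HighOp V)
  | ret (c : C) (r : HighResp V)

/-- The operation invoked at position `i` of `H` returns at position `j`, with response `r`:
`j` is the first return of the same client after `i`. (Operations are named by the position of
their invocation.) -/
def Returns {C V : Type*} (H : List (HEvent C V)) (i j : ℕ) (r : HighResp V) : Prop :=
  ∃ c op, H[i]? = some (.inv c op) ∧ i < j ∧ H[j]? = some (.ret c r) ∧
    ∀ m, i < m → m < j → ∀ r', H[m]? ≠ some (.ret c r')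

/-- The operation invoked at `i` returns before the operation invoked at `i'` is invoked. -/
def Precedes {C V : Type*} (H : List (HEvent C V)) (i i' : ℕ) : Prop :=
  ∃ j r, Returns H i j r ∧ j < i'

/-- `L` is a linearization of the schedule `H`: a legal sequence made of all complete operations
with their responses and of some pending operations with a response of one's choice, which respects
the precedence of operations in `H`. An entry of `L` is (name, operation, response). -/
structure IsLinearization {C V : Type*} [LinearOrder V] (v₀ : V) (H : List (HEvent C V))
    (L : List (ℕ × HighOp V × HighResp V)) : Prop where
  nodup : (L.map Prod.fst).Nodup
  invoked : ∀ x ∈ L, ∃ c, H[x.1]? = some (.inv c x.2.1)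
  response : ∀ x ∈ L, ∀ j r, Returns H x.1 j r → x.2.2 = r
  complete : ∀ i j r, Returns H i j r → i ∈ L.map Prod.fst
  order : L.Pairwise fun x y => ¬ Precedes H y.1 x.1
  legal : Legal v₀ (L.map Prod.snd)

/-! ### Low-level operations: the base registers -/

/-- Operations of a read/write base register over the value domain `D`. -/
inductive LowOp (D : Type*) where
  | write (d : D)
  | read

/-- Responses of a base register. -/
inductive LowResp (D : Type*) where
  | ack
  | val (d : D)

/-- The content of a register after an operation that finds the content `d`. -/
def LowOp.effect {D : Type*} : LowOp D → D → D
  | .write d', _ => d'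
  | .read, d => d

/-- The response of an operation that finds the content `d`. -/
def LowOp.answer {D : Type*} : LowOp D → D → LowResp D
  | .write _, _ => .ack
  | .read, d => .val d

/-- Status of a pending low-level operation: not yet applied to the register, or applied
with a response that has not yet been delivered. -/
inductive Pending (D : Type*) where
  | waiting (o : LowOp D)
  | applied (r : LowResp D)

/-! ### Algorithms and their runs -/

/-- What a client does on its own: trigger a low-level operation or return from the current
high-level operation. -/
inductive LocalAct (B D V : Type*) where
  | trigger (b : B) (o : LowOp D)
  | ret (r : HighResp V)

/-- An algorithm for clients `C` over base registers `B` with contents in `D`: for every client a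
deterministic state machine with states in `S`, and the initial contents of the registers. -/
structure Algorithm (C B D V S : Type*) where
  /-- initial local states -/
  initLoc : C → S
  /-- initial contents of the base registers -/
  initReg : B → D
  /-- local state after the invocation of a high-level operation -/
  onInvoke : C → S → HighOp V → S
  /-- local state after the response of a pending operation on a base register -/
  onRespond : C → S → B → LowResp D → S
  /-- the next own action and the local state after it; `none` if the client can only wait for
  responses -/
  next : C → S → Option (LocalAct B D V × S)

/-- A configuration. A client has at most one pending operation on each base register, but may
have pending operations on several registers. -/
structure Config (C B D S : Type*) where
  /-- local states -/
  loc : C → S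
  /-- clients with a high-level operation in progress -/
  busy : Set C
  /-- crashed clients -/
  crashed : Set C
  /-- contents of the base registers -/
  reg : B → D
  /-- pending low-level operations -/
  pend : C × B → Option (Pending D)

/-- Actions of a run. `apply c b` is the moment at which the pending operation of `c` on the atomic
register `b` takes effect. -/
inductive Action (C B D V : Type*) where
  | invoke (c : C) (op : HighOp V)
  | ret (c : C) (r : HighResp V)
  | trigger (c : C) (b : B) (o : LowOp D)
  | apply (c : C) (b : B)
  | respond (c : C) (b : B) (r : LowResp D)
  | crash (c : C)

/-- The high-level event of an action, if it is one. -/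
def Action.event {C B D V : Type*} : Action C B D V → Option (HEvent C V)
  | .invoke c op => some (.inv c op)
  | .ret c r => some (.ret c r)
  | _ => none

namespace Algorithm

variable {C B D V S : Type*}

/-- The initial configuration. -/
def initial (A : Algorithm C B D V S) : Config C B D S where
  loc := A.initLoc
  busy := ∅
  crashed := ∅
  reg := A.initReg
  pend := fun _ => none

open Classical in
/-- One step of the system. High-level reads can be invoked by every client, high-level writes only
by the clients in `W`. Base registers do not fail. -/
inductive Step (A : Algorithm C B D V S) (W : Finset C) :
    Config C B D S → Action C B D V → Config C B D S → Prop
  | invoke (γ : Config C B D S) (c : C) (op : HighOp V) :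
      c ∉ γ.crashed → c ∉ γ.busy → (∀ v, op = .writeMax v → c ∈ W) →
      Step A W γ (.invoke c op)
        { γ with
          loc := Function.update γ.loc c (A.onInvoke c (γ.loc c) op)
          busy := insert c γ.busy }
  | ret (γ : Config C B D S) (c : C) (r : HighResp V) (s : S) :
      c ∉ γ.crashed → c ∈ γ.busy → A.next c (γ.loc c) = some (.ret r, s) →
      Step A W γ (.ret c r)
        { γ with
          loc := Function.update γ.loc c s
          busy := γ.busy \ {c} }
  | trigger (γ : Config C B D S) (c : C) (b : B) (o : LowOp D) (s : S) :
      c ∉ γ.crashed → c ∈ γ.busy → A.next c (γ.loc c) = some (.trigger b o, s) →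
      γ.pend (c, b) = none →
      Step A W γ (.trigger c b o)
        { γ with
          loc := Function.update γ.loc c s
          pend := Function.update γ.pend (c, b) (some (.waiting o)) }
  | apply (γ : Config C B D S) (c : C) (b : B) (o : LowOp D) :
      γ.pend (c, b) = some (.waiting o) →
      Step A W γ (.apply c b)
        { γ with
          reg := Function.update γ.reg b (o.effect (γ.reg b))
          pend := Function.update γ.pend (c, b) (some (.applied (o.answer (γ.reg b)))) }
  | respond (γ : Config C B D S) (c : C) (b : B) (r : LowResp D) :
      c ∉ γ.crashed → γ.pend (c, b) = some (.applied r) →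
      Step A W γ (.respond c b r)
        { γ with
          loc := Function.update γ.loc c (A.onRespond c (γ.loc c) b r)
          pend := Function.update γ.pend (c, b) none }
  | crash (γ : Config C B D S) (c : C) :
      Step A W γ (.crash c) { γ with crashed := insert c γ.crashed }

/-- A run from the initial configuration. At each time an action is taken, or nothing happens
(`none`), so that finite runs are covered as well: they are the prefixes. -/
structure Run (A : Algorithm C B D V S) (W : Finset C) where
  /-- the configuration at time `t` -/
  cfg : ℕ → Config C B D S
  /-- the action between the times `t` and `t + 1` -/
  act : ℕ → Option (Action C B D V)
  start : cfg 0 = A.initial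
  step : ∀ t, match act t with
    | none => cfg (t + 1) = cfg t
    | some a => A.Step W (cfg t) a (cfg (t + 1))

namespace Run

variable {A : Algorithm C B D V S} {W : Finset C}

/-- The schedule of high-level invocations and returns before time `t`. -/
def history (ρ : Run A W) (t : ℕ) : List (HEvent C V) :=
  (List.range t).filterMap fun s => (ρ.act s).bind Action.event

/-- The base registers used before time `t`: those on which an operation was triggered. -/
def used (ρ : Run A W) (t : ℕ) : Set B :=
  {b | ∃ s < t, ∃ c o, ρ.act s = some (.trigger c b o)}

/-- The client never crashes. -/
def Correct (ρ : Run A W) (c : C) : Prop := ∀ t, c ∉ (ρ.cfg t).crashed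

/-- At time `t` the client triggers a low-level operation or returns. -/
def Moves (ρ : Run A W) (c : C) (t : ℕ) : Prop :=
  (∃ b o, ρ.act t = some (.trigger c b o)) ∨ ∃ r, ρ.act t = some (.ret c r)

/-- At time `t` the client is able to trigger a low-level operation or to return. -/
def CanMove (ρ : Run A W) (c : C) (t : ℕ) : Prop :=
  (∃ b o γ, A.Step W (ρ.cfg t) (.trigger c b o) γ) ∨ ∃ r γ, A.Step W (ρ.cfg t) (.ret c r) γ

/-- A run is fair if every low-level operation of a correct client eventually gets its response, and
every correct client gets infinitely many opportunities to trigger low-level operations and to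
return. -/
structure Fair (ρ : Run A W) : Prop where
  responds : ∀ c, ρ.Correct c → ∀ b t, (ρ.cfg t).pend (c, b) ≠ none →
    ∃ t' ≥ t, ∃ r, ρ.act t' = some (.respond c b r)
  opportunity : ∀ c, ρ.Correct c → ∀ t, ∃ t' ≥ t, ρ.Moves c t' ∨ ¬ ρ.CanMove c t'

end Run

/-- Atomicity: the schedule of high-level operations of every finite run has a linearization. -/
def Atomic [LinearOrder V] (A : Algorithm C B D V S) (W : Finset C) (v₀ : V) : Prop :=
  ∀ (ρ : Run A W) (t : ℕ), ∃ L, IsLinearization v₀ (ρ.history t) L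

/-- Wait freedom: in every fair run, every high-level operation invoked by a correct client
eventually returns. -/
def WaitFree (A : Algorithm C B D V S) (W : Finset C) : Prop :=
  ∀ ρ : Run A W, ρ.Fair → ∀ c, ρ.Correct c → ∀ t op, ρ.act t = some (.invoke c op) →
    ∃ t' > t, ∃ r, ρ.act t' = some (.ret c r)

/-- `A` implements a wait-free atomic max-register with set of writers `W` and initial
value `v₀`. -/
structure ImplementsMaxRegister [LinearOrder V] (A : Algorithm C B D V S) (W : Finset C)
    (v₀ : V) : Prop where
  atomic : A.Atomic W v₀
  waitFree : A.WaitFree W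

/-- Resource complexity: the maximal number of base registers used in a finite run. -/
noncomputable def resourceComplexity (A : Algorithm C B D V S) (W : Finset C) : ℕ∞ :=
  ⨆ (ρ : Run A W) (t : ℕ), (ρ.used t).encard

end Algorithm

end MaxReg

namespace MaxReg

/-! ### Linearizations of schedules that end with a read -/

/-! This is a covering argument. One builds reachable configurations in which `n` registers each
carry a triggered but unapplied write, each by a different writer, for `n = 0, …, k`. Every covered
register has been used, so `n = k` gives the bound.

To pass from `n` to `n + 1`, a writer `w` that covers nothing runs alone, writing a value `u` above
all values written so far and different from `v₀`. By wait freedom it would return. If it ever has a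
pending write outside the covered set `P`, it is stopped there and covers a new register. Otherwise
its whole operation changes only registers in `P`. The covering writes, applied afterwards, then
erase every trace of it: another client `c` cannot tell this run from the one in which `w` took no
step. A read by `c` thus gives the same answer in both, yet it must be `u` in the first and cannot
be `u` in the second.

The ingredients are `exists_solo_return` (termination of solo runs), `SoloExec.covers_or_reg_eq`
(the dichotomy for `w`), `blockWrite` (the erasure), `Sim` (indistinguishability), and
`IsLinearization.final_read_eq` and `IsLinearization.final_read_value` (the two constraints on the
read). They are combined in `Covers.exists_insert`.

Clients may have operations pending on several registers. Solo runs are therefore scheduled so that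
a client acts on its own only when nothing of its own is pending; with `OnePending`, a writer covers
only one register. -/

lemma mem_writtenValues {V : Type*} {l : List (HighOp V × HighResp V)} {v : V} :
    v ∈ writtenValues l ↔ ∃ r, (HighOp.writeMax v, r) ∈ l := by
  unfold writtenValues
  rw [List.mem_filterMap]
  constructor
  · rintro ⟨⟨op, r⟩, hx, h⟩
    cases op with
    | writeMax v' => simp at h; subst h; exact ⟨r, hx⟩
    | readMax => simp at h
  · rintro ⟨r, hr⟩
    exact ⟨_, hr, rfl⟩

section Linearization

variable {C V : Type*} [LinearOrder V] {v₀ : V} {H : List (HEvent C V)}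
  {L : List (ℕ × HighOp V × HighResp V)} {c : C} {r : HighResp V}

lemma IsLinearization.final_read
    (h : IsLinearization v₀ (H ++ [.inv c .readMax, .ret c r]) L) :
    ∃ p, L[p]? = some (H.length, .readMax, r) ∧
      r = .value ((writtenValues ((L.map Prod.snd).take p)).maximum.unbotD v₀) := by
  have hret : Returns (H ++ [.inv c .readMax, .ret c r]) H.length (H.length + 1) r := by
    refine ⟨c, .readMax, by simp, by omega, by simp, fun m h1 h2 => by omega⟩
  have hmem := h.complete _ _ _ hret
  obtain ⟨⟨q, op, r'⟩, hx, hq⟩ := List.mem_map.1 hmem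
  simp only at hq
  subst hq
  obtain ⟨c', hc'⟩ := h.invoked _ hx
  have hr' := h.response _ hx _ _ hret
  simp at hc' hr'
  obtain ⟨-, rfl⟩ := hc'
  subst hr'
  obtain ⟨p, hp⟩ := List.mem_iff_getElem?.1 hx
  refine ⟨p, hp, ?_⟩
  exact h.legal p .readMax r' (by simp [hp])

lemma IsLinearization.writtenValues_invoked (h : IsLinearization v₀ H L) (p : ℕ) {v : V}
    (hv : v ∈ writtenValues ((L.map Prod.snd).take p)) : ∃ d, .inv d (.writeMax v) ∈ H := by
  obtain ⟨r', hr'⟩ := mem_writtenValues.1 hv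
  obtain ⟨⟨i, x⟩, hx, hxe⟩ := List.mem_map.1 (List.mem_of_mem_take hr')
  simp only at hxe
  subst hxe
  obtain ⟨d, hd⟩ := h.invoked _ hx
  exact ⟨d, List.mem_of_getElem? hd⟩

/-- A read returns the initial value or a value whose write has been invoked. -/
lemma IsLinearization.final_read_value {u : V}
    (h : IsLinearization v₀ (H ++ [.inv c .readMax, .ret c (.value u)]) L) :
    u = v₀ ∨ ∃ d, .inv d (.writeMax u) ∈ H := by
  obtain ⟨p, -, hr⟩ := h.final_read
  simp only [HighResp.value.injEq] at hr
  cases hm : (writtenValues ((L.map Prod.snd).take p)).maximum with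
  | bot => left; simpa [hm] using hr
  | coe m =>
    rw [hm] at hr
    simp at hr
    subst hr
    obtain ⟨d, hd⟩ := h.writtenValues_invoked p (List.maximum_mem hm)
    exact Or.inr ⟨d, by simpa using hd⟩

/-- A read that follows a complete write of the highest value invoked so far returns it. -/
lemma IsLinearization.final_read_eq {u : V} {w : C} {r₀ : HighResp V} {H' : List (HEvent C V)}
    (h : IsLinearization v₀ ((H ++ .inv w (.writeMax u) :: .ret w r₀ :: H') ++
      [.inv c .readMax, .ret c r]) L)
    (hle : ∀ d v, .inv d (.writeMax v) ∈ H ++ .inv w (.writeMax u) :: .ret w r₀ :: H' → v ≤ u) :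
    r = .value u := by
  obtain ⟨p, hp, hr⟩ := h.final_read
  have hret : Returns ((H ++ .inv w (.writeMax u) :: .ret w r₀ :: H') ++
      [.inv c .readMax, .ret c r]) H.length (H.length + 1) r₀ := by
    refine ⟨w, .writeMax u, by simp, by omega, by simp,
      fun m h1 h2 => by omega⟩
  obtain ⟨⟨i, op, r'⟩, hx, hi⟩ := List.mem_map.1 (h.complete _ _ _ hret)
  simp only at hi
  subst hi
  obtain ⟨c', hc'⟩ := h.invoked _ hx
  simp at hc'
  obtain ⟨-, rfl⟩ := hc'
  obtain ⟨q, hq⟩ := List.mem_iff_getElem?.1 hx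
  -- Were the read placed before the write in `L`, real-time order would be violated; `p = q` is
  -- impossible since the two entries carry different operations.
  have hqp : q < p := by
    by_contra hcon
    have hlt : p < q := by
      rcases Nat.lt_or_ge p q with h1 | h1
      · exact h1
      · have : p = q := by omega
        subst this
        rw [hp] at hq
        simp at hq
    obtain ⟨hp1, hp2⟩ := List.getElem?_eq_some_iff.1 hp
    obtain ⟨hq1, hq2⟩ := List.getElem?_eq_some_iff.1 hq
    have := List.pairwise_iff_getElem.1 h.order p q hp1 hq1 hlt
    rw [hp2, hq2] at this
    exact this ⟨_, _, hret, by simp⟩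
  have hu : u ∈ writtenValues ((L.map Prod.snd).take p) := by
    refine mem_writtenValues.2 ⟨r', List.mem_iff_getElem?.2 ⟨q, ?_⟩⟩
    simp [hqp, hq]
  cases hm : (writtenValues ((L.map Prod.snd).take p)).maximum with
  | bot =>
    rw [List.maximum_eq_bot] at hm
    simp [hm] at hu
  | coe m =>
    have h1 : u ≤ m := List.le_maximum_of_mem hu hm
    obtain ⟨d, hd⟩ := h.writtenValues_invoked p (List.maximum_mem hm)
    have h2 : m ≤ u := hle d m (by simpa using hd)
    rw [hr, hm, le_antisymm h1 h2]
    rfl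

end Linearization

namespace Algorithm

variable {C B D V S : Type*}

/-! ### Finite executions -/

/-- `Exec A W γ l δ`: the actions `l` lead from `γ` to `δ`. -/
inductive Exec (A : Algorithm C B D V S) (W : Finset C) :
    Config C B D S → List (Action C B D V) → Config C B D S → Prop
  | nil (γ : Config C B D S) : Exec A W γ [] γ
  | cons {γ δ ε : Config C B D S} {a : Action C B D V} {l : List (Action C B D V)} :
      A.Step W γ a δ → Exec A W δ l ε → Exec A W γ (a :: l) ε

variable {A : Algorithm C B D V S} {W : Finset C} {γ δ ε : Config C B D S}
  {a : Action C B D V} {l l' : List (Action C B D V)} {c d : C}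

lemma Exec.append (h : Exec A W γ l δ) (h' : Exec A W δ l' ε) : Exec A W γ (l ++ l') ε := by
  induction h with
  | nil => exact h'
  | cons hs _ ih => exact .cons hs (ih h')

lemma Exec.single (h : A.Step W γ a δ) : Exec A W γ [a] δ := .cons h (.nil _)

lemma Exec.concat (h : Exec A W γ l δ) (h' : A.Step W δ a ε) : Exec A W γ (l ++ [a]) ε :=
  h.append (.single h')

/-- A step, or nothing. -/
def OStep (A : Algorithm C B D V S) (W : Finset C) (γ : Config C B D S)
    (o : Option (Action C B D V)) (δ : Config C B D S) : Prop :=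
  match o with
  | none => δ = γ
  | some a => A.Step W γ a δ

/-- A finite execution followed by an infinite one is an infinite one. -/
lemma Exec.extend (h : Exec A W γ l δ) (cfg : ℕ → Config C B D S)
    (act : ℕ → Option (Action C B D V)) (h0 : cfg 0 = δ)
    (hs : ∀ t, A.OStep W (cfg t) (act t) (cfg (t + 1))) :
    ∃ (cfg' : ℕ → Config C B D S) (act' : ℕ → Option (Action C B D V)), cfg' 0 = γ ∧
      (∀ t, A.OStep W (cfg' t) (act' t) (cfg' (t + 1))) ∧
      (∀ t, cfg' (l.length + t) = cfg t) ∧ (∀ t, act' (l.length + t) = act t) ∧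
      ∀ t < l.length, act' t = l[t]? := by
  induction h with
  | nil => exact ⟨cfg, act, h0, hs, by simp, by simp, by simp⟩
  | @cons γ δ ε a l hstep _ ih =>
    obtain ⟨cfg', act', h0', hs', hc, ha, hl⟩ := ih h0
    refine ⟨fun t => Nat.casesOn t γ cfg', fun t => Nat.casesOn t (some a) act', rfl, ?_, ?_, ?_,
      ?_⟩
    · intro t
      cases t with
      | zero => simpa [OStep, h0'] using hstep
      | succ t => exact hs' t
    · intro t
      rw [List.length_cons, Nat.add_right_comm]
      exact hc t
    · intro t
      rw [List.length_cons, Nat.add_right_comm]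
      exact ha t
    · intro t ht
      cases t with
      | zero => simp
      | succ t => simpa using hl t (by simpa using ht)

/-- An execution from the initial configuration with an infinite continuation, as a run. -/
lemma Exec.exists_run (h : Exec A W A.initial l δ) (cfg : ℕ → Config C B D S)
    (act : ℕ → Option (Action C B D V)) (h0 : cfg 0 = δ)
    (hs : ∀ t, A.OStep W (cfg t) (act t) (cfg (t + 1))) :
    ∃ ρ : Run A W, (∀ t, ρ.cfg (l.length + t) = cfg t) ∧
      (∀ t, ρ.act (l.length + t) = act t) ∧ ∀ t < l.length, ρ.act t = l[t]? := by
  obtain ⟨cfg', act', h0', hs', hc, ha, hl⟩ := h.extend cfg act h0 hs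
  exact ⟨⟨cfg', act', h0', fun t => by have := hs' t; unfold OStep at this; exact this⟩, hc, ha, hl⟩

lemma Exec.exists_finite_run (h : Exec A W A.initial l δ) :
    ∃ ρ : Run A W, ∀ t < l.length, ρ.act t = l[t]? := by
  obtain ⟨ρ, -, -, hl⟩ := h.exists_run (fun _ => δ) (fun _ => none) rfl (fun _ => rfl)
  exact ⟨ρ, hl⟩

/-- The schedule of high-level events of a finite execution. -/
def events (l : List (Action C B D V)) : List (HEvent C V) := l.filterMap Action.event

@[simp] lemma events_nil : events ([] : List (Action C B D V)) = [] := rfl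

@[simp] lemma events_append (l l' : List (Action C B D V)) :
    events (l ++ l') = events l ++ events l' := List.filterMap_append

lemma events_cons (a : Action C B D V) (l : List (Action C B D V)) :
    events (a :: l) = events [a] ++ events l := events_append [a] l

lemma Run.history_eq_events (ρ : Run A W) (h : ∀ t < l.length, ρ.act t = l[t]?) :
    ρ.history l.length = events l := by
  unfold Run.history events
  have : l = (List.range l.length).filterMap ρ.act := by
    have h1 : ∀ n ≤ l.length, (List.range n).filterMap ρ.act = l.take n := by
      intro n hn
      induction n with
      | zero => simp
      | succ n ih =>
        rw [List.range_succ, List.filterMap_append, ih (by omega), List.take_add_one,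
          ← h n (by omega)]
        congr 1
    rw [h1 _ le_rfl, List.take_length]
  conv_rhs => rw [this, List.filterMap_filterMap]

lemma Exec.exists_isLinearization [LinearOrder V] {v₀ : V} (hA : A.Atomic W v₀)
    (h : Exec A W A.initial l δ) : ∃ L, IsLinearization v₀ (events l) L := by
  obtain ⟨ρ, hρ⟩ := h.exists_finite_run
  have := hA ρ l.length
  rwa [ρ.history_eq_events hρ] at this

/-- Only a trigger turns an empty pending slot into an occupied one, so a covered register has been
used. -/
lemma Exec.exists_trigger (h : Exec A W γ l δ) {b : B} (h0 : γ.pend (c, b) = none)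
    (h1 : δ.pend (c, b) ≠ none) : ∃ o, Action.trigger c b o ∈ l := by
  classical
  induction h with
  | nil => exact absurd h0 h1
  | @cons γ δ ε a l hstep _ ih =>
    by_cases hδ : δ.pend (c, b) = none
    · obtain ⟨o, ho⟩ := ih hδ h1
      exact ⟨o, List.mem_cons_of_mem _ ho⟩
    · cases hstep with
      | trigger c' b' o s _ _ _ _ =>
        by_cases hcb : (c, b) = (c', b')
        · cases hcb
          exact ⟨o, by simp⟩
        · exact absurd (by simpa [Function.update_apply, hcb] using h0) hδ
      | apply c' b' o hp =>
        by_cases hcb : (c, b) = (c', b')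
        · cases hcb
          simp [h0] at hp
        · exact absurd (by simpa [Function.update_apply, hcb] using h0) hδ
      | respond c' b' r _ hp =>
        by_cases hcb : (c, b) = (c', b')
        · cases hcb
          simp [h0] at hp
        · exact absurd (by simpa [Function.update_apply, hcb] using h0) hδ
      | _ => exact absurd h0 hδ

/-- Registers with pending operations count for the resource complexity. -/
lemma Exec.card_le_resourceComplexity (h : Exec A W A.initial l δ) (P : Finset B)
    (hP : ∀ b ∈ P, ∃ c, δ.pend (c, b) ≠ none) : (P.card : ℕ∞) ≤ A.resourceComplexity W := by
  obtain ⟨ρ, hρ⟩ := h.exists_finite_run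
  refine le_trans ?_ (le_iSup_of_le ρ (le_iSup_of_le l.length le_rfl))
  rw [← Set.encard_coe_eq_coe_finsetCard]
  refine Set.encard_le_encard fun b hb => ?_
  obtain ⟨c, hc⟩ := hP b hb
  obtain ⟨o, ho⟩ := h.exists_trigger rfl hc
  obtain ⟨s, hs⟩ := List.mem_iff_getElem?.1 ho
  have hlt := (List.getElem?_eq_some_iff.1 hs).1
  exact ⟨s, hlt, c, o, by rw [hρ s hlt, hs]⟩

end Algorithm

/-! ### Actions of one client -/

/-- The client of an action. -/
def Action.client {C B D V : Type*} : Action C B D V → C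
  | .invoke c _ => c
  | .ret c _ => c
  | .trigger c _ _ => c
  | .apply c _ => c
  | .respond c _ _ => c
  | .crash c => c

/-- Triggers, applications and responses of low-level operations. -/
def Action.IsLow {C B D V : Type*} : Action C B D V → Prop
  | .trigger _ _ _ => True
  | .apply _ _ => True
  | .respond _ _ _ => True
  | _ => False

namespace Algorithm

variable {C B D V S : Type*} {A : Algorithm C B D V S} {W : Finset C} {γ δ ε : Config C B D S}
  {a : Action C B D V} {l l' : List (Action C B D V)} {c d : C}

/-- Two configurations that the client `c` cannot distinguish on its own. -/
structure Sim (c : C) (γ γ' : Config C B D S) : Prop where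
  loc : γ.loc c = γ'.loc c
  busy : c ∈ γ.busy ↔ c ∈ γ'.busy
  crashed : c ∈ γ.crashed ↔ c ∈ γ'.crashed
  reg : γ.reg = γ'.reg
  pend : ∀ b, γ.pend (c, b) = γ'.pend (c, b)

/-- The guards and effects of an action of `c` involve only the local state, status and pending
operations of `c` and the registers, which is what `Sim` records. -/
lemma Sim.step {γ' : Config C B D S} (h : Sim c γ γ') (hs : A.Step W γ a δ) (ha : a.client = c) :
    ∃ δ', A.Step W γ' a δ' ∧ Sim c δ δ' := by
  classical
  obtain ⟨hl, hb, hc, hr, hp⟩ := h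
  cases hs with
  | invoke c' op h1 h2 h3 =>
    cases ha
    exact ⟨_, .invoke γ' _ op (hc.not.1 h1) (hb.not.1 h2) h3,
      by constructor <;> simp_all [Action.client]⟩
  | ret c' r s h1 h2 h3 =>
    cases ha
    exact ⟨_, .ret γ' _ r s (hc.not.1 h1) (hb.1 h2) (hl ▸ h3),
      by constructor <;> simp_all [Action.client]⟩
  | trigger c' b o s h1 h2 h3 h4 =>
    cases ha
    exact ⟨_, .trigger γ' _ b o s (hc.not.1 h1) (hb.1 h2) (hl ▸ h3) ((hp b).symm.trans h4),
      by constructor <;> simp_all [Action.client, Function.update_apply]⟩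
  | apply c' b o h1 =>
    cases ha
    exact ⟨_, .apply γ' _ b o ((hp b).symm.trans h1),
      by constructor <;> simp_all [Action.client, Function.update_apply]⟩
  | respond c' b r h1 h2 =>
    cases ha
    exact ⟨_, .respond γ' _ b r (hc.not.1 h1) ((hp b).symm.trans h2),
      by constructor <;> simp_all [Action.client, Function.update_apply]⟩
  | crash c' =>
    cases ha
    exact ⟨_, .crash γ' _, by constructor <;> simp_all [Action.client]⟩

lemma Sim.exec {γ' : Config C B D S} (h : Sim c γ γ') (hs : Exec A W γ l δ)
    (ha : ∀ a ∈ l, a.client = c) : ∃ δ', Exec A W γ' l δ' ∧ Sim c δ δ' := by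
  induction hs generalizing γ' with
  | nil => exact ⟨_, .nil _, h⟩
  | cons hs _ ih =>
    obtain ⟨δ', hδ', hsim⟩ := h.step hs (ha _ (by simp))
    obtain ⟨ε', hε', hsim'⟩ := ih hsim fun a ha' => ha a (List.mem_cons_of_mem _ ha')
    exact ⟨ε', .cons hδ' hε', hsim'⟩

/-- `γ` and `δ` agree on everything that only other clients than `c` can change. -/
structure Frame (c : C) (γ δ : Config C B D S) : Prop where
  loc : ∀ d ≠ c, δ.loc d = γ.loc d
  busy : ∀ d ≠ c, (d ∈ δ.busy ↔ d ∈ γ.busy)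
  crashed : δ.crashed = γ.crashed
  pend : ∀ d ≠ c, ∀ b, δ.pend (d, b) = γ.pend (d, b)

lemma Frame.refl (c : C) (γ : Config C B D S) : Frame c γ γ :=
  ⟨fun _ _ => rfl, fun _ _ => Iff.rfl, rfl, fun _ _ _ => rfl⟩

lemma Frame.trans (h : Frame c γ δ) (h' : Frame c δ ε) : Frame c γ ε :=
  ⟨fun d hd => (h'.loc d hd).trans (h.loc d hd), fun d hd => (h'.busy d hd).trans (h.busy d hd),
    h'.crashed.trans h.crashed, fun d hd b => (h'.pend d hd b).trans (h.pend d hd b)⟩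

lemma Step.frame (h : A.Step W γ a δ) (ha : a ≠ .crash a.client) : Frame a.client γ δ := by
  classical
  cases h with
  | crash c' => exact absurd rfl ha
  | _ =>
    constructor <;> simp +contextual [Action.client]

/-- The client has at most one pending low-level operation. -/
def OnePending (c : C) (γ : Config C B D S) : Prop :=
  ∀ b b', γ.pend (c, b) ≠ none → γ.pend (c, b') ≠ none → b = b'

/-- The client has no operation in progress, neither high-level nor low-level. -/
def Idle (c : C) (γ : Config C B D S) : Prop := c ∉ γ.busy ∧ ∀ b, γ.pend (c, b) = none

lemma Frame.idle (h : Frame c γ δ) (hd : d ≠ c) (hi : Idle d γ) : Idle d δ :=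
  ⟨(h.busy d hd).not.2 hi.1, fun b => (h.pend d hd b).trans (hi.2 b)⟩

lemma Frame.onePending (h : Frame c γ δ) (hd : d ≠ c) (hi : OnePending d γ) : OnePending d δ := by
  intro b b' h1 h2
  rw [h.pend d hd] at h1 h2
  exact hi b b' h1 h2

/-- Low-level steps of a single client that never has two pending operations. -/
inductive SoloExec (A : Algorithm C B D V S) (W : Finset C) (c : C) :
    Config C B D S → List (Action C B D V) → Config C B D S → Prop
  | nil (γ : Config C B D S) : SoloExec A W c γ [] γ
  | cons {γ δ ε : Config C B D S} {a : Action C B D V} {l : List (Action C B D V)} :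
      A.Step W γ a δ → a.client = c → a.IsLow → OnePending c δ →
      SoloExec A W c δ l ε → SoloExec A W c γ (a :: l) ε

namespace SoloExec

lemma exec (h : SoloExec A W c γ l δ) : Exec A W γ l δ := by
  induction h with
  | nil => exact .nil _
  | cons hs _ _ _ _ ih => exact .cons hs ih

lemma client (h : SoloExec A W c γ l δ) : ∀ a ∈ l, a.client = c := by
  induction h with
  | nil => simp
  | cons _ ha _ _ _ ih => simpa [ha] using ih

lemma events_eq_nil (h : SoloExec A W c γ l δ) : events l = [] := by
  induction h with
  | nil => simp
  | @cons γ δ ε a l _ _ ha _ _ ih =>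
    rw [events_cons, ih]
    cases a <;> simp_all [Action.IsLow, events, Action.event]

lemma frame (h : SoloExec A W c γ l δ) : Frame c γ δ := by
  induction h with
  | nil => exact .refl _ _
  | @cons γ δ ε a l hs hc ha _ _ ih =>
    refine Frame.trans (hc ▸ hs.frame ?_) ih
    rintro h
    rw [h] at ha
    exact ha

lemma append (h : SoloExec A W c γ l δ) (h' : SoloExec A W c δ l' ε) :
    SoloExec A W c γ (l ++ l') ε := by
  induction h with
  | nil => exact h'
  | cons hs h1 h2 h3 _ ih => exact .cons hs h1 h2 h3 (ih h')

lemma onePending (h : SoloExec A W c γ l δ) (h0 : OnePending c γ) : OnePending c δ := by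
  induction h with
  | nil => exact h0
  | cons _ _ _ h1 _ ih => exact ih h1

/-- Unless the client comes to have a pending write on a register outside `P`, it does not change
the registers outside `P`. -/
lemma covers_or_reg_eq (h : SoloExec A W c γ l δ) (P : Set B)
    (hP : ∀ b d, γ.pend (c, b) = some (.waiting (.write d)) → b ∈ P) :
    (∃ l' δ' b d, SoloExec A W c γ l' δ' ∧ δ'.pend (c, b) = some (.waiting (.write d)) ∧ b ∉ P) ∨
      ∀ b ∉ P, δ.reg b = γ.reg b := by
  classical
  induction h with
  | nil => exact Or.inr fun _ _ => rfl
  | @cons γ δ ε a l hs hc ha h1 _ ih =>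
    by_cases hδ : ∀ b d, δ.pend (c, b) = some (.waiting (.write d)) → b ∈ P
    · rcases ih hδ with ⟨l', δ', b, d, hl, hb⟩ | hreg
      · exact Or.inl ⟨_, δ', b, d, .cons hs hc ha h1 hl, hb⟩
      · refine Or.inr fun b hb => (hreg b hb).trans ?_
        -- Only the application of a write changes a register, and that write was pending just
        -- before, hence on a register of `P`.
        cases hs with
        | apply c' b' o hp =>
          cases hc
          simp only [Function.update_apply]
          split_ifs with hbb
          · subst hbb
            cases o with
            | read => rfl
            | write d => exact absurd (hP _ d hp) hb
          · rfl
        | _ => rfl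
    · push Not at hδ
      obtain ⟨b, d, hb, hbP⟩ := hδ
      exact Or.inl ⟨[a], δ, b, d, .cons hs hc ha h1 (.nil _), hb, hbP⟩

end SoloExec

lemma Sim.onePending (h : Sim c γ δ) (h1 : OnePending c γ) : OnePending c δ := by
  intro b b'
  rw [← h.pend, ← h.pend]
  exact h1 b b'

lemma Sim.soloExec {γ' : Config C B D S} (h : Sim c γ γ') (hs : SoloExec A W c γ l δ) :
    ∃ δ', SoloExec A W c γ' l δ' ∧ Sim c δ δ' := by
  induction hs generalizing γ' with
  | nil => exact ⟨_, .nil _, h⟩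
  | cons hs h1 h2 h3 _ ih =>
    obtain ⟨δ', hδ', hsim⟩ := h.step hs h1
    obtain ⟨ε', hε', hsim'⟩ := ih hsim
    exact ⟨ε', .cons hδ' h1 h2 (hsim.onePending h3) hε', hsim'⟩

/-! ### Properties of runs -/

namespace Run

variable (ρ : Run A W)

lemma oStep (t : ℕ) : A.OStep W (ρ.cfg t) (ρ.act t) (ρ.cfg (t + 1)) := by
  have := ρ.step t
  unfold OStep
  exact this

lemma crashed_mono {t : ℕ} (n : ℕ) (h : c ∈ (ρ.cfg t).crashed) :
    c ∈ (ρ.cfg (t + n)).crashed := by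
  induction n with
  | zero => exact h
  | succ n ih =>
    have hs := ρ.oStep (t + n)
    rw [Nat.add_assoc] at hs
    generalize ρ.cfg (t + (n + 1)) = δ at hs ⊢
    generalize ρ.act (t + n) = o at hs
    cases o with
    | none => rw [show δ = _ from hs]; exact ih
    | some a => cases (show A.Step W _ a δ from hs) <;> simp [ih]

/-- Only the delivery of a response empties a pending slot. This reduces the first fairness
condition to slots becoming empty. -/
lemma exists_respond {b : B} {t : ℕ} (n : ℕ) (h0 : (ρ.cfg t).pend (c, b) ≠ none)
    (h1 : (ρ.cfg (t + n)).pend (c, b) = none) :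
    ∃ t' ≥ t, ∃ r, ρ.act t' = some (.respond c b r) := by
  classical
  induction n with
  | zero => exact absurd h1 h0
  | succ n ih =>
    by_cases hn : (ρ.cfg (t + n)).pend (c, b) = none
    · exact ih hn
    · have hs := ρ.oStep (t + n)
      rw [Nat.add_assoc] at hs
      generalize ρ.cfg (t + (n + 1)) = δ at hs h1
      cases ho : ρ.act (t + n) with
      | none =>
        rw [ho] at hs
        rw [show δ = _ from hs] at h1
        exact absurd h1 hn
      | some a =>
        rw [ho] at hs
        cases (show A.Step W _ a δ from hs) with
        | trigger c' b' o s _ _ _ _ =>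
          simp only [Function.update_apply] at h1
          split_ifs at h1
          exact absurd h1 hn
        | apply c' b' o hp =>
          simp only [Function.update_apply] at h1
          split_ifs at h1
          exact absurd h1 hn
        | respond c' b' r _ hp =>
          simp only [Function.update_apply] at h1
          split_ifs at h1 with h2
          · cases h2
            exact ⟨t + n, by omega, r, ho⟩
          · exact absurd h1 hn
        | _ => exact absurd h1 hn

/-- A busy client has invoked an operation that has not returned yet. -/
lemma exists_invoke {t : ℕ} (h : c ∈ (ρ.cfg t).busy) :
    ∃ s < t, ∃ op, ρ.act s = some (.invoke c op) ∧
      ∀ s', s < s' → s' < t → ∀ r, ρ.act s' ≠ some (.ret c r) := by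
  induction t with
  | zero => rw [ρ.start] at h; simp [initial] at h
  | succ t ih =>
    have key : c ∈ (ρ.cfg t).busy → (∀ r, ρ.act t ≠ some (.ret c r)) →
        ∃ s < t + 1, ∃ op, ρ.act s = some (.invoke c op) ∧
          ∀ s', s < s' → s' < t + 1 → ∀ r, ρ.act s' ≠ some (.ret c r) := by
      intro h1 h2
      obtain ⟨s, hs, op, hop, hr⟩ := ih h1
      refine ⟨s, by omega, op, hop, fun s' h3 h4 => ?_⟩
      rcases Nat.lt_succ_iff_lt_or_eq.1 h4 with h5 | rfl
      · exact hr s' h3 h5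
      · exact h2
    have hs := ρ.oStep t
    generalize ρ.cfg (t + 1) = δ at hs h
    cases ho : ρ.act t with
    | none =>
      rw [ho] at hs
      rw [show δ = _ from hs] at h
      exact key h (by simp [ho])
    | some a =>
      rw [ho] at hs
      cases (show A.Step W _ a δ from hs) with
      | invoke c' op h1 h2 h3 =>
        by_cases hc : c = c'
        · subst hc
          exact ⟨t, by omega, op, ho, fun s' h4 h5 => by omega⟩
        · exact key (by simpa [hc] using h) (by simp [ho])
      | ret c' r s _ _ _ =>
        have hc : c ≠ c' := fun hc => h.2 hc
        exact key h.1 (by simp [ho, hc.symm])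
      | _ => exact key h (by simp [ho])

end Run

/-! ### Solo runs -/

/-- A step of a client that waits for the completion of its low-level operations before its next
own action. -/
structure SoloStep (A : Algorithm C B D V S) (W : Finset C) (c : C) (γ : Config C B D S)
    (o : Option (Action C B D V)) (δ : Config C B D S) : Prop where
  oStep : A.OStep W γ o δ
  client : ∀ a, o = some a → a.client = c ∧ (a.IsLow ∨ ∃ r, a = .ret c r)
  onePending : OnePending c δ
  crashed : δ.crashed = γ.crashed
  waiting : ∀ b p, γ.pend (c, b) = some (.waiting p) → ∃ r, δ.pend (c, b) = some (.applied r)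
  applied : ∀ b r, γ.pend (c, b) = some (.applied r) → ∀ b', δ.pend (c, b') = none
  move : (∀ b, γ.pend (c, b) = none) → (∃ b p, o = some (.trigger c b p)) ∨
    (∃ r, o = some (.ret c r)) ∨
    ((¬ ∃ b p ε, A.Step W γ (.trigger c b p) ε) ∧ ¬ ∃ r ε, A.Step W γ (.ret c r) ε)

/-- The scheduler gives priority to the pending operation: apply it, then deliver its response. Only
with nothing pending may the client trigger or return, and it stalls only if it can do neither. -/
lemma exists_soloStep (hc : c ∉ γ.crashed) (h1 : OnePending c γ) :
    ∃ o δ, SoloStep A W c γ o δ := by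
  classical
  by_cases hp : ∀ b, γ.pend (c, b) = none
  · by_cases ht : ∃ b p ε, A.Step W γ (.trigger c b p) ε
    · obtain ⟨b, p, ε, hs⟩ := ht
      refine ⟨some (.trigger c b p), ε, hs, by simp [Action.client, Action.IsLow], ?_, ?_,
        by simp [hp], by simp [hp], fun _ => Or.inl ⟨b, p, rfl⟩⟩
      · cases hs
        intro b1 b2 h3 h4
        simp [Function.update_apply, hp] at h3 h4
        rw [h3, h4]
      · cases hs; rfl
    · by_cases hr : ∃ r ε, A.Step W γ (.ret c r) ε
      · obtain ⟨r, ε, hs⟩ := hr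
        refine ⟨some (.ret c r), ε, hs, by simp [Action.client], ?_, ?_, by simp [hp], by simp [hp],
          fun _ => Or.inr (Or.inl ⟨r, rfl⟩)⟩
        · cases hs; exact h1
        · cases hs; rfl
      · exact ⟨none, γ, rfl, by simp, h1, rfl, by simp [hp], by simp [hp],
          fun _ => Or.inr (Or.inr ⟨ht, hr⟩)⟩
  · push Not at hp
    obtain ⟨b, hb⟩ := hp
    have hb' : ∀ b', b' ≠ b → γ.pend (c, b') = none := fun b' hne => by
      by_contra h
      exact hne (h1 b' b h hb)
    cases hpb : γ.pend (c, b) with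
    | none => exact absurd hpb hb
    | some q =>
      cases q with
      | waiting p =>
        refine ⟨some (.apply c b), _, Step.apply γ c b p hpb,
          by simp [Action.client, Action.IsLow], ?_, rfl, ?_, ?_, fun h => absurd (h b) hb⟩
        · intro b1 b2 h3 h4
          by_cases e1 : b1 = b
          · by_cases e2 : b2 = b
            · rw [e1, e2]
            · simp [e2, hb'] at h4
          · simp [e1, hb'] at h3
        · intro b1 p1 h3
          by_cases e1 : b1 = b
          · subst e1; simp
          · simp [hb' _ e1] at h3
        · intro b1 p1 h3
          by_cases e1 : b1 = b
          · subst e1; simp [hpb] at h3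
          · simp [hb' _ e1] at h3
      | applied r =>
        have hn : ∀ b', Function.update γ.pend (c, b) none (c, b') = none := fun b' => by
          by_cases e1 : b' = b
          · simp [e1]
          · simp [e1, hb']
        refine ⟨some (.respond c b r), _, Step.respond γ c b r hc hpb,
          by simp [Action.client, Action.IsLow], fun b1 _ h3 => ?_, rfl, ?_, ?_,
          fun h => absurd (h b) hb⟩
        · exact absurd (by convert hn b1) h3
        · intro b1 p1 h3
          by_cases e1 : b1 = b
          · subst e1; simp [hpb] at h3
          · simp [hb' _ e1] at h3
        · intro _ _ _ b'
          convert hn b'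

lemma SoloStep.frame {o : Option (Action C B D V)} (h : SoloStep A W c γ o δ) : Frame c γ δ := by
  cases o with
  | none => rw [show δ = γ from h.oStep]; exact .refl _ _
  | some a =>
    obtain ⟨rfl, h2⟩ := h.client a rfl
    refine (show A.Step W γ a δ from h.oStep).frame fun h3 => ?_
    rw [h3] at h2
    simp [Action.IsLow] at h2

/-- The infinite solo run of a client. -/
lemma exists_solo_run (A : Algorithm C B D V S) (W : Finset C) (hc : c ∉ γ.crashed)
    (h1 : OnePending c γ) :
    ∃ (cfg : ℕ → Config C B D S) (act : ℕ → Option (Action C B D V)), cfg 0 = γ ∧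
      ∀ t, SoloStep A W c (cfg t) (act t) (cfg (t + 1)) := by
  have key : ∀ x : {γ : Config C B D S // c ∉ γ.crashed ∧ OnePending c γ},
      ∃ (y : Option (Action C B D V) × {γ : Config C B D S // c ∉ γ.crashed ∧ OnePending c γ}),
        SoloStep A W c x.1 y.1 y.2.1 := by
    rintro ⟨γ, h2, h3⟩
    obtain ⟨o, δ, h⟩ := exists_soloStep (A := A) (W := W) h2 h3
    exact ⟨⟨o, δ, h.crashed ▸ h2, h.onePending⟩, h⟩
  choose f hf using key
  let g : ℕ → {γ : Config C B D S // c ∉ γ.crashed ∧ OnePending c γ} :=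
    fun t => Nat.rec ⟨γ, hc, h1⟩ (fun _ x => (f x).2) t
  exact ⟨fun t => (g t).1, fun t => (f (g t)).1, rfl, fun t => hf (g t)⟩

/-- Crashing silences clients whose pending operations would otherwise have to be answered in a fair
run. -/
lemma exists_crash_exec (A : Algorithm C B D V S) (W : Finset C) (γ : Config C B D S)
    (F : Finset C) :
    ∃ l, Exec A W γ l { γ with crashed := γ.crashed ∪ F } := by
  classical
  induction F using Finset.induction_on with
  | empty => exact ⟨[], by simpa using Exec.nil γ⟩
  | insert d F _ ih =>
    obtain ⟨l, hl⟩ := ih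
    refine ⟨_, hl.concat (a := .crash d) ?_⟩
    convert Step.crash _ d using 2
    simp [Set.union_insert]

/-- A wait-free operation terminates when its client runs alone. -/
lemma exists_solo_return (hA : A.WaitFree W) (hl : Exec A W A.initial l γ) (hb : c ∈ γ.busy)
    (hc : c ∉ γ.crashed) (h1 : OnePending c γ) (hi : ∀ d ≠ c, d ∉ W → Idle d γ) :
    ∃ m δ r δ', SoloExec A W c γ m δ ∧ A.Step W δ (.ret c r) δ' := by
  classical
  -- Only the other writers are crashed: they are finitely many, whereas `C` may be infinite. The
  -- remaining clients are idle and may stay correct. Since `c` does not notice the crashes, its run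
  -- can be carried back to `γ`.
  let γ' : Config C B D S := { γ with crashed := γ.crashed ∪ ↑(W.erase c) }
  have hsim : Sim c γ' γ := ⟨rfl, Iff.rfl, by simp [γ'], rfl, fun _ => rfl⟩
  have hc' : c ∉ γ'.crashed := hsim.crashed.not.2 hc
  obtain ⟨l', hl'⟩ := exists_crash_exec A W γ (W.erase c)
  have hexec : Exec A W A.initial (l ++ l') γ' := hl.append hl'
  obtain ⟨cfg, act, h0, hs⟩ := exists_solo_run (γ := γ') A W hc' h1
  obtain ⟨ρ, hρc, hρa, -⟩ := hexec.exists_run cfg act h0 fun t => (hs t).oStep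
  generalize (l ++ l').length = N at hρc hρa
  have hframe : ∀ t, Frame c γ' (cfg t) := by
    intro t
    induction t with
    | zero => rw [h0]; exact .refl _ _
    | succ t ih => exact ih.trans (hs t).frame
  -- A pending operation disappears within two steps, applied and then answered, so `c` gets an
  -- opportunity to act infinitely often.
  have hnone : ∀ t, ∃ t' ≥ t, ∀ b, (cfg t').pend (c, b) = none := by
    intro t
    by_cases hp : ∀ b, (cfg t).pend (c, b) = none
    · exact ⟨t, le_rfl, hp⟩
    · push Not at hp
      obtain ⟨b, hb⟩ := hp
      cases hpb : (cfg t).pend (c, b) with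
      | none => exact absurd hpb hb
      | some q =>
        cases q with
        | waiting p =>
          obtain ⟨r, hr⟩ := (hs t).waiting b p hpb
          exact ⟨t + 2, by omega, (hs (t + 1)).applied b r hr⟩
        | applied r => exact ⟨t + 1, by omega, (hs t).applied b r hpb⟩
  have hcorrect : ∀ d, ρ.Correct d → d ≠ c → ∀ t, Idle d (ρ.cfg (N + t)) := by
    intro d hd hdc t
    rw [hρc]
    refine (hframe t).idle hdc (hi d hdc fun hW => hd (N + 0) ?_)
    rw [hρc, h0]
    exact Or.inr (by simp [hW, hdc])
  have hfair : ρ.Fair := by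
    constructor
    · intro d hd b t hp
      obtain ⟨n, hn⟩ : ∃ n, (ρ.cfg (t + n)).pend (d, b) = none := by
        by_cases hdc : d = c
        · subst hdc
          obtain ⟨t', ht', hn⟩ := hnone t
          refine ⟨N + t' - t, ?_⟩
          rw [show t + (N + t' - t) = N + t' by omega, hρc]
          exact hn b
        · refine ⟨N, ?_⟩
          rw [Nat.add_comm]
          exact (hcorrect d hd hdc t).2 b
      exact ρ.exists_respond n hp hn
    · intro d hd t
      by_cases hdc : d = c
      · subst hdc
        obtain ⟨t', ht', hn⟩ := hnone t
        refine ⟨N + t', by omega, ?_⟩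
        unfold Run.Moves Run.CanMove
        rw [hρa, hρc]
        rcases (hs t').move hn with h | h | h
        · exact Or.inl (Or.inl h)
        · exact Or.inl (Or.inr h)
        · exact Or.inr (not_or.2 h)
      · refine ⟨N + t, by omega, Or.inr ?_⟩
        have hid := (hcorrect d hd hdc t).1
        rintro (⟨b, o, ε, h⟩ | ⟨r, ε, h⟩)
        · cases h; contradiction
        · cases h; contradiction
  have hcc : ρ.Correct c := by
    intro t h
    have := ρ.crashed_mono N h
    rw [Nat.add_comm, hρc, (hframe t).crashed] at this
    exact hc' this
  have hbusy : c ∈ (ρ.cfg N).busy := by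
    have := hρc 0
    rw [Nat.add_zero] at this
    rw [this, h0]
    exact hb
  obtain ⟨s, hsN, op, hop, hnr⟩ := ρ.exists_invoke hbusy
  obtain ⟨t', ht', r, hr⟩ := hA ρ hfair c hcc s op hop
  have hNt : N ≤ t' := by
    by_contra h
    exact hnr t' ht' (by omega) r hr
  obtain ⟨n, rfl⟩ := Nat.exists_eq_add_of_le hNt
  rw [hρa] at hr
  -- Up to the first return, all actions of the solo part are low-level.
  have hex : ∃ n, ∃ r, act n = some (.ret c r) := ⟨n, r, hr⟩
  have hsolo : ∀ j ≤ Nat.find hex, ∃ m, SoloExec A W c γ' m (cfg j) := by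
    intro j
    induction j with
    | zero => intro _; exact ⟨[], h0 ▸ .nil _⟩
    | succ j ih =>
      intro hj
      obtain ⟨m, hm⟩ := ih (by omega)
      have hstep := (hs j).oStep
      cases ho : act j with
      | none =>
        rw [ho] at hstep
        exact ⟨m, (show cfg (j + 1) = cfg j from hstep) ▸ hm⟩
      | some a =>
        rw [ho] at hstep
        obtain ⟨h3, h4 | ⟨r, h4⟩⟩ := (hs j).client a ho
        · exact ⟨_, hm.append (.cons hstep h3 h4 (hs j).onePending (.nil _))⟩
        · exact absurd ⟨r, h4 ▸ ho⟩ (Nat.find_min hex (show j < Nat.find hex by omega))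
  obtain ⟨m, hm⟩ := hsolo _ le_rfl
  obtain ⟨r, hr⟩ := Nat.find_spec hex
  have hret := (hs (Nat.find hex)).oStep
  rw [hr] at hret
  obtain ⟨δ, hδ, hsimδ⟩ := hsim.soloExec hm
  obtain ⟨δ', hδ', -⟩ := hsimδ.step hret rfl
  exact ⟨m, δ, r, δ', hδ, hδ'⟩

/-! ### Block writes -/

open Classical in
/-- The configuration after the client `e b` has written `g b` to `b`, for all `b` in `P`. -/
noncomputable def blockWrite (γ : Config C B D S) (P : Finset B) (e : B → C) (g : B → D) :
    Config C B D S :=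
  { γ with
    reg := fun b => if b ∈ P then g b else γ.reg b
    pend := fun p => if p.2 ∈ P ∧ p.1 = e p.2 then some (.applied .ack) else γ.pend p }

/-- The writes hit distinct registers, so they can be applied one after another in any order. Their
responses stay undelivered, so no local state changes and no slot is freed. -/
lemma exists_blockWrite_exec (A : Algorithm C B D V S) (W : Finset C) {P : Finset B} {e : B → C}
    {g : B → D} (h : ∀ b ∈ P, γ.pend (e b, b) = some (.waiting (.write (g b)))) :
    ∃ l, Exec A W γ l (blockWrite γ P e g) ∧ events l = [] := by
  classical
  induction P using Finset.induction_on with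
  | empty => exact ⟨[], by simpa [blockWrite] using Exec.nil γ, rfl⟩
  | insert b P hb ih =>
    obtain ⟨l, hl, hev⟩ := ih fun b' hb' => h b' (Finset.mem_insert_of_mem hb')
    have hp : (blockWrite γ P e g).pend (e b, b) = some (.waiting (.write (g b))) := by
      simpa [blockWrite, hb] using h b (Finset.mem_insert_self _ _)
    refine ⟨l ++ [.apply (e b) b], ?_, by rw [events_append, hev]; rfl⟩
    convert hl.concat (Step.apply _ _ _ _ hp) using 1
    unfold blockWrite
    congr 1
    · funext b'
      by_cases hbb : b' = b
      · subst hbb; simp [LowOp.effect]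
      · simp [hbb]
    · funext p
      obtain ⟨d, b'⟩ := p
      by_cases hbb : b' = b
      · subst hbb
        by_cases hd : d = e b'
        · subst hd; simp [LowOp.answer]
        · simp [hd, hb]
      · simp [hbb]

lemma blockWrite_pend_eq_none {P : Finset B} {e : B → C} {g : B → D}
    (h : ∀ b ∈ P, γ.pend (e b, b) ≠ none) (p : C × B) :
    (blockWrite γ P e g).pend p = none ↔ γ.pend p = none := by
  obtain ⟨d, b⟩ := p
  simp only [blockWrite]
  split_ifs with hp
  · obtain ⟨hb, rfl⟩ := hp
    simpa using h b hb
  · rfl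

/-! ### Complete operations -/

/-- A client that runs alone completes its operation, and does the same in any configuration that
it cannot distinguish. -/
lemma exists_complete_pair (hA : A.WaitFree W) (hl : Exec A W A.initial l γ) (hb : c ∈ γ.busy)
    (hc : c ∉ γ.crashed) (h1 : OnePending c γ) (hi : ∀ d ≠ c, d ∉ W → Idle d γ)
    {γ' : Config C B D S} (hsim : Sim c γ γ') :
    ∃ m δ δ' r, Exec A W γ m δ ∧ Exec A W γ' m δ' ∧ Sim c δ δ' ∧ events m = [.ret c r] ∧
      c ∉ δ.busy ∧ Frame c γ δ ∧ OnePending c δ := by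
  obtain ⟨m, δ, r, δ', hm, hδ⟩ := exists_solo_return hA hl hb hc h1 hi
  have hex : Exec A W γ (m ++ [.ret c r]) δ' := hm.exec.concat hδ
  obtain ⟨ε, hε, hs⟩ := hsim.exec hex (by
    intro a ha
    rcases List.mem_append.1 ha with h | h
    · exact hm.client a h
    · rw [List.mem_singleton.1 h]; rfl)
  refine ⟨_, δ', ε, r, hex, hε, hs, by rw [events_append, hm.events_eq_nil]; rfl, ?_,
    hm.frame.trans (hδ.frame (by simp)), ?_⟩
  · cases hδ; simp
  · have h2 := hm.onePending h1
    cases hδ; exact h2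

/-- A client completes its operation, if it has one in progress, and reads. -/
lemma exists_read_pair (hA : A.WaitFree W) (hl : Exec A W A.initial l γ)
    (hc : c ∉ γ.crashed) (h1 : OnePending c γ) (hi : ∀ d ≠ c, d ∉ W → Idle d γ)
    {γ' : Config C B D S} (hsim : Sim c γ γ') :
    ∃ m m' δ δ' E r, Exec A W γ m δ ∧ Exec A W γ' m' δ' ∧
      events m = E ++ [.inv c .readMax, .ret c r] ∧
      events m' = E ++ [.inv c .readMax, .ret c r] ∧ ∀ d op, HEvent.inv d op ∉ E := by
  obtain ⟨m, δ, δ', E, hm, hm', hs, hE, hEi, hb, hf, h2⟩ : ∃ m δ δ' E, Exec A W γ m δ ∧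
      Exec A W γ' m δ' ∧ Sim c δ δ' ∧ events m = E ∧ (∀ d op, HEvent.inv d op ∉ E) ∧
      c ∉ δ.busy ∧ Frame c γ δ ∧ OnePending c δ := by
    -- The reader may itself be one of the covering writers, since `C` may contain no other client
    -- besides `w`; it then has to finish its write first. This contributes one return and no
    -- invocation to `E`.
    by_cases hb : c ∈ γ.busy
    · obtain ⟨m, δ, δ', r, hm, hm', hs, hE, h⟩ := exists_complete_pair hA hl hb hc h1 hi hsim
      exact ⟨m, δ, δ', _, hm, hm', hs, hE, by simp, h⟩
    · exact ⟨[], γ, γ', [], .nil _, .nil _, hsim, rfl, by simp, hb, .refl _ _, h1⟩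
  have hcδ : c ∉ δ.crashed := hf.crashed ▸ hc
  have hinv := Step.invoke (A := A) (W := W) δ c .readMax hcδ hb (by simp)
  obtain ⟨ε', hinv', hsim'⟩ := hs.step hinv rfl
  have hf' := hf.trans (hinv.frame (by simp))
  obtain ⟨n, ζ, ζ', r, hn, hn', -, hev, -⟩ := exists_complete_pair hA
    ((hl.append hm).concat hinv) (by simp) hcδ h2 (fun d hd hW => hf'.idle hd (hi d hd hW)) hsim'
  refine ⟨m ++ .invoke c .readMax :: n, m ++ .invoke c .readMax :: n, ζ, ζ', E, r,
    hm.append (.cons hinv hn), hm'.append (.cons hinv' hn'), ?_, ?_, hEi⟩ <;>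
  · rw [events_append, hE, events_cons, hev]; rfl

/-! ### The covering argument -/

/-- A reachable configuration without crashes in which every register of `P` is covered by a pending
write, of the client `e b` in `W` for `b ∈ P`, and all other clients are idle. All values written so
far are in `U`. -/
structure Covers (A : Algorithm C B D V S) (W : Finset C) (U : Set V) (P : Finset B) (e : B → C)
    (l : List (Action C B D V)) (γ : Config C B D S) : Prop where
  exec : Exec A W A.initial l γ
  values : ∀ d v, .inv d (.writeMax v) ∈ events l → v ∈ U
  mem : ∀ b ∈ P, e b ∈ W
  covered : ∀ b ∈ P, ∃ x, γ.pend (e b, b) = some (.waiting (.write x))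
  onePending : ∀ d, OnePending d γ
  idle : ∀ d, (∀ b ∈ P, d ≠ e b) → Idle d γ
  crashed : γ.crashed = ∅

lemma Covers.initial (A : Algorithm C B D V S) (W : Finset C) (e : B → C) :
    Covers A W ∅ ∅ e [] A.initial where
  exec := .nil _
  values := by simp
  mem := by simp
  covered := by simp
  onePending := fun d b b' h => absurd rfl h
  idle := fun d _ => ⟨by simp [Algorithm.initial], fun _ => rfl⟩
  crashed := rfl

/-- If one more writer writes a new highest value, it can be stopped while it covers one more
register. -/
lemma Covers.exists_insert [LinearOrder V] [Nontrivial C] {v₀ u : V} {U : Set V} {P : Finset B}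
    {e : B → C} (hA : A.ImplementsMaxRegister W v₀) (h : Covers A W U P e l γ)
    (hU : ∀ v ∈ U, v < u) (hu : u ≠ v₀) (hP : P.card < W.card) :
    ∃ P' : Finset B, P'.card = P.card + 1 ∧ ∃ e' l' γ', Covers A W (insert u U) P' e' l' γ' := by
  classical
  -- The covering clients number at most `P.card < W.card`, so some writer covers nothing.
  obtain ⟨w, hwW, hw⟩ : ∃ w ∈ W, ∀ b ∈ P, w ≠ e b := by
    by_contra! hcon
    refine absurd hP (not_lt.2 ((Finset.card_le_card fun w hw => ?_).trans
      (Finset.card_image_le (s := P) (f := e))))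
    obtain ⟨b, hb, rfl⟩ := hcon w hw
    exact Finset.mem_image_of_mem _ hb
  have hwi := h.idle w hw
  have hwc : w ∉ γ.crashed := by simp [h.crashed]
  have hinv := Step.invoke (A := A) (W := W) γ w (.writeMax u) hwc hwi.1 (fun _ _ => hwW)
  set γ₁ : Config C B D S := { γ with
    loc := Function.update γ.loc w (A.onInvoke w (γ.loc w) (.writeMax u))
    busy := insert w γ.busy } with hγ₁
  have hf₁ : Frame w γ γ₁ := hinv.frame (by simp)
  have hexec₁ := h.exec.concat hinv
  have hidle : ∀ d, d ∉ W → Idle d γ := fun d hd => h.idle d fun b hb hdb => hd (hdb ▸ h.mem b hb)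
  have hone₁ : OnePending w γ₁ := h.onePending w
  obtain ⟨m, γ₂, r₀, γ₃, hm, hret⟩ := exists_solo_return hA.waitFree hexec₁ (by simp [hγ₁]) hwc
    hone₁ (fun d hd hW => hf₁.idle hd (hidle d hW))
  have hvals : ∀ d v, HEvent.inv d (.writeMax v) ∈ events (l ++ [.invoke w (.writeMax u)]) →
      v ∈ insert u U := by
    intro d v hv
    rw [events_append, List.mem_append] at hv
    rcases hv with hv | hv
    · exact Or.inr (h.values d v hv)
    · simp [events, Action.event] at hv
      exact Or.inl hv.2
  -- The hypothesis on pending writes is vacuous, as `w` was idle before its invocation.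
  rcases hm.covers_or_reg_eq (P : Set B) (by simp [hγ₁, hwi.2]) with
    ⟨m', γ', b, x, hm', hx, hb⟩ | hreg
  · have hf : Frame w γ γ' := hf₁.trans hm'.frame
    have hbP : ∀ b' ∈ P, b' ≠ b := fun b' hb' hbb => hb (hbb ▸ hb')
    refine ⟨insert b P, Finset.card_insert_of_notMem hb, Function.update e b w, _, γ',
      hexec₁.append hm'.exec, ?_, ?_, ?_, ?_, ?_,
      hf.crashed.trans h.crashed⟩
    · rw [events_append, hm'.events_eq_nil, List.append_nil]
      exact hvals
    · intro b' hb'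
      rcases Finset.mem_insert.1 hb' with rfl | hb'
      · simpa using hwW
      · simpa [hbP b' hb'] using h.mem b' hb'
    · intro b' hb'
      rcases Finset.mem_insert.1 hb' with rfl | hb'
      · exact ⟨x, by simpa using hx⟩
      · obtain ⟨y, hy⟩ := h.covered b' hb'
        refine ⟨y, ?_⟩
        rw [Function.update_of_ne (hbP b' hb'), hf.pend _ (hw b' hb').symm, hy]
    · intro d
      by_cases hd : d = w
      · subst hd; exact hm'.onePending hone₁
      · exact hf.onePending hd (h.onePending d)
    · intro d hd
      have hdw : d ≠ w := by simpa using hd b (Finset.mem_insert_self _ _)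
      refine hf.idle hdw (h.idle d fun b' hb' => ?_)
      simpa [hbP b' hb'] using hd b' (Finset.mem_insert_of_mem hb')
  · exfalso
    have hf : Frame w γ γ₃ := (hf₁.trans hm.frame).trans (hret.frame (by simp))
    have hreg₃ : ∀ b ∉ P, γ₃.reg b = γ.reg b := by
      intro b hb
      have h2 := hreg b hb
      cases hret
      exact h2
    obtain ⟨c, hcw⟩ := exists_ne w
    obtain ⟨g, hg⟩ : ∃ g : B → D, ∀ b ∈ P, γ.pend (e b, b) = some (.waiting (.write (g b))) := by
      refine Classical.skolem (p := fun b x => b ∈ P →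
        γ.pend (e b, b) = some (.waiting (.write x))).1 fun b => ?_
      by_cases hb : b ∈ P
      · obtain ⟨x, hx⟩ := h.covered b hb
        exact ⟨x, fun _ => hx⟩
      -- Any element of `D` serves outside `P`.
      · exact ⟨A.initReg b, fun h => absurd h hb⟩
    have hg₃ : ∀ b ∈ P, γ₃.pend (e b, b) = some (.waiting (.write (g b))) := fun b hb => by
      rw [hf.pend _ (hw b hb).symm, hg b hb]
    have hnn : ∀ b ∈ P, γ.pend (e b, b) ≠ none := fun b hb => by simp [hg b hb]
    obtain ⟨n, hn, hne⟩ := exists_blockWrite_exec A W hg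
    obtain ⟨n₃, hn₃, hne₃⟩ := exists_blockWrite_exec A W hg₃
    -- The registers in `P` now hold the block-written values in both configurations; those outside
    -- were never changed by `w`.
    have hsim : Sim c (blockWrite γ P e g) (blockWrite γ₃ P e g) := by
      constructor
      · exact (hf.loc c hcw).symm
      · exact (hf.busy c hcw).symm
      · simp [blockWrite, hf.crashed]
      · funext b
        by_cases hb : b ∈ P
        · simp [blockWrite, hb]
        · simp [blockWrite, hb, hreg₃ b hb]
      · intro b
        simp [blockWrite, hf.pend c hcw]
    obtain ⟨q, q₃, δ, δ₃, E, r, hq, hq₃, hE, hE₃, hEi⟩ := exists_read_pair hA.waitFree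
      (h.exec.append hn) (by simp [blockWrite, h.crashed])
      (fun b b' h1 h2 => h.onePending c b b' (mt (blockWrite_pend_eq_none hnn _).2 h1)
        (mt (blockWrite_pend_eq_none hnn _).2 h2))
      (fun d _ hW => ⟨(hidle d hW).1,
        fun b => (blockWrite_pend_eq_none hnn _).2 ((hidle d hW).2 b)⟩) hsim
    have hrun := (h.exec.append hn).append hq
    have hrun₃ := (((hexec₁.append hm.exec).concat hret).append hn₃).append hq₃
    obtain ⟨L, hL⟩ := hrun.exists_isLinearization hA.atomic
    obtain ⟨L₃, hL₃⟩ := hrun₃.exists_isLinearization hA.atomic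
    have hev : events ((l ++ n) ++ q) = (events l ++ E) ++ [.inv c .readMax, .ret c r] := by
      simp [hne, hE]
    have hev₃ : events ((((l ++ [.invoke w (.writeMax u)]) ++ m) ++ [.ret w r₀] ++ n₃) ++ q₃) =
        (events l ++ .inv w (.writeMax u) :: .ret w r₀ :: E) ++
          [.inv c .readMax, .ret c r] := by
      simp only [events_append, hne₃, hE₃, hm.events_eq_nil]
      simp [events, Action.event]
    rw [hev] at hL
    rw [hev₃] at hL₃
    -- In the run with the write of `w`, that write is complete and `u` is the highest value
    -- invoked; in the other run, treated below, `u` is neither invoked nor equal to `v₀`.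
    have hr : r = .value u := by
      refine hL₃.final_read_eq fun d v hv => ?_
      simp only [List.mem_append, List.mem_cons, HEvent.inv.injEq, HighOp.writeMax.injEq,
        reduceCtorEq, hEi, or_false] at hv
      rcases hv with hv | ⟨-, rfl⟩
      · exact (hU v (h.values d v hv)).le
      · exact le_rfl
    subst hr
    rcases hL.final_read_value with h2 | ⟨d, hd⟩
    · exact hu h2
    · rcases List.mem_append.1 hd with hd | hd
      · exact lt_irrefl u (hU u (h.values d u hd))
      · exact hEi _ _ hd

/-- The values are written in increasing order, so each is a new maximum when its turn comes. -/
lemma exists_covers [LinearOrder V] [Nontrivial C] {v₀ : V}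
    (hA : A.ImplementsMaxRegister W v₀) {k : ℕ} (hk : k ≤ W.card) (v : Fin k → V)
    (hv : StrictMono v) (hv₀ : ∀ i, v i ≠ v₀) (n : ℕ) (hn : n ≤ k) :
    ∃ P : Finset B, P.card = n ∧ ∃ e l γ, Covers A W (v '' {i | i.val < n}) P e l γ := by
  classical
  induction n with
  | zero =>
    refine ⟨∅, rfl, fun _ => Classical.arbitrary C, [], A.initial, ?_⟩
    simpa using Covers.initial A W _
  | succ n ih =>
    obtain ⟨P, hP, e, l, γ, h⟩ := ih (by omega)
    obtain ⟨P', hP', e', l', γ', h'⟩ := h.exists_insert (u := v ⟨n, hn⟩) hA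
      (by rintro _ ⟨i, hi, rfl⟩; exact hv hi) (hv₀ _) (by omega)
    refine ⟨P', by rw [hP', hP], e', l', γ', ?_⟩
    convert h' using 1
    rw [← Set.image_insert_eq]
    congr 1
    ext i
    simp [Fin.ext_iff, le_iff_eq_or_lt]

end Algorithm

/-- Removing `v₀` leaves at least `k` values. They need not exceed `v₀`, which is answered only when
nothing has been written and does not compete with the written values. -/
lemma exists_strictMono_ne {V : Type*} [LinearOrder V] (v₀ : V) {k : ℕ}
    (hV : (k : ℕ∞) < ENat.card V) : ∃ v : Fin k → V, StrictMono v ∧ ∀ i, v i ≠ v₀ := by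
  have h : (k : ℕ∞) ≤ ({v₀}ᶜ : Set V).encard := by
    have h1 := Set.encard_add_encard_compl ({v₀} : Set V)
    rw [Set.encard_singleton, Set.encard_univ, add_comm] at h1
    rw [← h1] at hV
    exact (ENat.lt_add_one_iff' (ENat.natCast_ne_top k)).1 hV
  obtain ⟨T, hT, hTk⟩ := Set.exists_subset_encard_eq h
  have hfin : T.Finite := Set.finite_of_encard_eq_coe hTk
  have hcard : hfin.toFinset.card = k := by
    rw [hfin.encard_eq_coe_toFinset_card] at hTk
    exact_mod_cast hTk
  refine ⟨hfin.toFinset.orderEmbOfFin hcard, OrderEmbedding.strictMono _, fun i => ?_⟩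
  have := hfin.toFinset.orderEmbOfFin_mem hcard i
  exact hT (hfin.mem_toFinset.1 this)

end MaxReg

theorem mainTheorem3 {C B D V S : Type*} [LinearOrder V] [Nontrivial C]
    (k : ℕ) (hk : 0 < k) (W : Finset C) (hW : W.card = k)
    (v₀ : V) (hV : (k : ℕ∞) < ENat.card V)
    (A : MaxReg.Algorithm C B D V S) (hA : A.ImplementsMaxRegister W v₀) :
    (k : ℕ∞) ≤ A.resourceComplexity W ∧ (k : ℕ∞) ≤ ENat.card B := by
  obtain ⟨v, hv, hv₀⟩ := MaxReg.exists_strictMono_ne v₀ hV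
  obtain ⟨P, hP, e, l, γ, h⟩ := MaxReg.Algorithm.exists_covers hA hW.ge v hv hv₀ k le_rfl
  subst hP
  refine ⟨h.exec.card_le_resourceComplexity P fun b hb => ?_, ?_⟩
  · obtain ⟨x, hx⟩ := h.covered b hb
    exact ⟨e b, by simp [hx]⟩
  · rw [← Set.encard_coe_eq_coe_finsetCard, ← Set.encard_univ]
    exact Set.encard_le_encard (Set.subset_univ _)
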